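/- Fix positive integers $d$ and $n$. Let $W_d(n)$ be the number of $2n$-step walks in the integer lattice $\mathbb{Z}^d$ which begin and end at the origin, where each step has unit length (so each step adds $\pm\mathbf{e}_i$ for some standard basis vector $\mathbf{e}_i$). For a positive integer $x$, let $\nu_2(x)$ denote the exponent of $2$ in the prime factorisation of $x$, and let $w_d(n) = \nu_2(W_d(n))$. Let $s_2(n)$ be the number of $1$s in the binary expansion of $n$ (written with the most significant digit first and without leading zeroes). Then: (a) If $\nu_2(d) = 0$, then $w_d(n) = s_2(n)$. (b) If $\nu_2(d) = 1$, then $w_d(n) = 2s_2(n)$. (c) If $\nu_2(d) = 2$, then $w_d(n) \ge 3s_2(n)$, with equality if and only if the binary expansion of $n$ does not contain two adjacent $1$s. (d) If $\nu_2(d) \ge 3$, then $w_d(n) \ge 3s_2(n) + \nu_2(d) - 2$, with equality if and only if, in the binary expansion of $n$, all of the $1$s come before all of the $0$s. -/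

import Mathlib

/-- The closed `2n`-step walks in the lattice `ℤ^d` which begin and end at the origin. A walk is the
sequence of its `2n + 1` successive positions; each step has unit length, so that two successive
positions differ by `1` in exactly one coordinate and agree in all other coordinates. -/
def closedWalks (d n : ℕ) : Set (Fin (2 * n + 1) → Fin d → ℤ) :=
  {p | p 0 = 0 ∧ p (Fin.last (2 * n)) = 0 ∧
    ∀ k : Fin (2 * n), ∑ i : Fin d, |p k.succ i - p k.castSucc i| = 1}

/-- There are only finitely many such walks, so that counting them with `Set.ncard` is meaningful. -/
theorem closedWalks_finite (d n : ℕ) : (closedWalks d n).Finite := by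
  refine Set.Finite.subset
    (Set.finite_Icc (fun _ _ => -(2 * n : ℤ)) (fun _ _ => (2 * n : ℤ))) ?_
  rintro p ⟨h0, -, hs⟩
  have key : ∀ k : Fin (2 * n + 1), ∀ i, |p k i| ≤ (k : ℕ) := by
    intro k
    induction k using Fin.induction with
    | zero => intro i; simp [h0]
    | succ k ih =>
      intro i
      have h1 : |p k.succ i - p k.castSucc i| ≤ 1 := by
        rw [← hs k]
        exact Finset.single_le_sum (f := fun i => |p k.succ i - p k.castSucc i|)
          (fun _ _ => abs_nonneg _) (Finset.mem_univ i)
      have h2 := ih i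
      simp only [Fin.val_castSucc, Fin.val_succ] at *
      rw [abs_le] at *
      push_cast
      constructor <;> linarith [h1.1, h1.2, h2.1, h2.2]
  refine Set.mem_Icc.2 ⟨fun k i => ?_, fun k i => ?_⟩ <;>
  · have := abs_le.1 (key k i)
    have := k.is_lt
    dsimp only
    omega

/-- `W_d(n)`: the number of closed `2n`-step walks in `ℤ^d` based at the origin. -/
noncomputable def walkCount (d n : ℕ) : ℕ := (closedWalks d n).ncard

/-- `w_d(n)`: the exponent of `2` in the prime factorisation of `W_d(n)`. -/
noncomputable def walkVal (d n : ℕ) : ℕ := padicValNat 2 (walkCount d n)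

/-- The binary expansion of `n`, most significant digit first, without leading zeroes. -/
def binaryExpansion (n : ℕ) : List ℕ := (Nat.digits 2 n).reverse

/-- `s_2(n)`: the number of `1`s in the binary expansion of `n`. -/
def binaryOnes (n : ℕ) : ℕ := (binaryExpansion n).count 1

open Finset.HasAntidiagonal (antidiagonal mem_antidiagonal)
open PowerSeries (coeff derivative)

/-! Write s for the binary digit sum and ν for the 2-adic valuation. Counting walks with exponential
generating functions, one coordinate at a time, gives W_d(n) = (2n)! · [xⁿ] B^d with B = ∑ xⁿ/n!²
(`walkCount_eq`). As ν((2n)!) = 2n - s(n), it remains to find the valuation of the coefficients g_n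
of B^d.

The logarithmic derivative L = xB'/B satisfies the Riccati equation xL' = x - L². In the resulting
recurrence for its coefficients l_n, off-diagonal terms pair up with a factor 2, and induction gives
ν(l_n) ≥ 4s(n) - 2 + ν(n) - 2n, with equality exactly when the ones of n precede its zeroes
(`hasResidue_logDeriv`).

Next, x(B^d)' = d·L·B^d reads n·g_n = d ∑ l_i g_j over i + j = n. A second induction
(`hasResidue_pow_coeff`) tracks a lower bound for ν(g_n) and the residue mod 2 at that bound; only
terms of minimal valuation matter. If ν(d) ≤ 1, the only such term has i equal to the lowest binary
one of n. If ν(d) = 2, i ranges over the blocks cut from the low end of the lowest run of ones, and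
the parity of the sum detects adjacent ones (`sum_noAdjacentOnes`). If ν(d) ≥ 3, only i = n
survives, so g_n inherits the equality condition of l_n. -/

/-! ### Binary digit sums and 2-adic valuations -/

theorem binaryOnes_zero : binaryOnes 0 = 0 := by simp [binaryOnes, binaryExpansion]

theorem binaryExpansion_two_mul {m : ℕ} (hm : m ≠ 0) :
    binaryExpansion (2 * m) = binaryExpansion m ++ [0] := by
  have h := Nat.digits_add 2 one_lt_two 0 m two_pos (Or.inr hm)
  rw [zero_add] at h
  simp [binaryExpansion, h]

theorem binaryExpansion_two_mul_add_one (m : ℕ) :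
    binaryExpansion (2 * m + 1) = binaryExpansion m ++ [1] := by
  have h := Nat.digits_add 2 one_lt_two 1 m one_lt_two (Or.inl one_ne_zero)
  rw [add_comm] at h
  rw [binaryExpansion, h, List.reverse_cons, binaryExpansion]

theorem binaryOnes_two_mul (m : ℕ) : binaryOnes (2 * m) = binaryOnes m := by
  rcases eq_or_ne m 0 with rfl | hm
  · rfl
  · simp [binaryOnes, binaryExpansion_two_mul hm]

theorem binaryOnes_two_mul_add_one (m : ℕ) : binaryOnes (2 * m + 1) = binaryOnes m + 1 := by
  simp [binaryOnes, binaryExpansion_two_mul_add_one]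

theorem sum_digits_two (n : ℕ) : (Nat.digits 2 n).sum = binaryOnes n := by
  induction n using Nat.evenOddRec with
  | h0 => simp [binaryOnes_zero]
  | h_even m ih =>
    rcases eq_or_ne m 0 with rfl | hm
    · simp [binaryOnes_zero]
    · have h := Nat.digits_add 2 one_lt_two 0 m two_pos (Or.inr hm)
      rw [zero_add] at h
      rw [binaryOnes_two_mul, ← ih, h, List.sum_cons, zero_add]
  | h_odd m ih =>
    have h := Nat.digits_add 2 one_lt_two 1 m one_lt_two (Or.inl one_ne_zero)
    rw [add_comm] at h
    rw [binaryOnes_two_mul_add_one, ← ih, h, List.sum_cons, add_comm]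

theorem padicValNat_two_factorial (n : ℕ) : padicValNat 2 n.factorial + binaryOnes n = n := by
  have h := sub_one_mul_padicValNat_factorial (p := 2) n
  have h2 := Nat.digit_sum_le 2 n
  rw [sum_digits_two] at h h2
  omega

/-- Kummer's theorem via Legendre's formula: the defect of additivity of the digit sum, that is the
number of carries, is a valuation and hence nonnegative. -/
theorem padicValNat_two_choose_add (j m : ℕ) :
    padicValNat 2 ((j + m).choose j) + binaryOnes (j + m) = binaryOnes j + binaryOnes m := by
  have h := Nat.add_choose_mul_factorial_mul_factorial m j
  rw [add_comm m j] at h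
  have h2 := congrArg (padicValNat 2) h
  rw [padicValNat.mul (mul_ne_zero (Nat.choose_pos (by omega)).ne' (Nat.factorial_ne_zero _))
    (Nat.factorial_ne_zero _), padicValNat.mul (Nat.choose_pos (by omega)).ne'
    (Nat.factorial_ne_zero _)] at h2
  have h3 := padicValNat_two_factorial j
  have h4 := padicValNat_two_factorial m
  have h5 := padicValNat_two_factorial (j + m)
  omega

theorem binaryOnes_add_le (j m : ℕ) : binaryOnes (j + m) ≤ binaryOnes j + binaryOnes m := by
  have := padicValNat_two_choose_add j m
  omega

/-- With n = j + m, the identity n·C(n-1, j-1) = j·C(n, j) bounds ν(n) - ν(j) by ν(C(n, j)), the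
number of carries. -/
theorem padicValNat_add_binaryOnes_add_le {j : ℕ} (hj : 0 < j) (m : ℕ) :
    padicValNat 2 (j + m) + binaryOnes (j + m) ≤
      padicValNat 2 j + binaryOnes j + binaryOnes m := by
  have h := padicValNat_two_choose_add j m
  obtain ⟨i, rfl⟩ := Nat.exists_eq_succ_of_ne_zero hj.ne'
  have h1 := Nat.add_one_mul_choose_eq (i + m) i
  have h2 := congrArg (padicValNat 2) h1
  have hc : (i + m).choose i ≠ 0 := (Nat.choose_pos (by omega)).ne'
  have hc2 : (i + m + 1).choose (i + 1) ≠ 0 := (Nat.choose_pos (by omega)).ne'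
  rw [padicValNat.mul (by omega) hc, padicValNat.mul hc2 (by omega)] at h2
  rw [Nat.succ_eq_add_one, show i + 1 + m = i + m + 1 by ring] at *
  omega

theorem binaryOnes_pos {n : ℕ} (hn : 0 < n) : 0 < binaryOnes n := by
  induction n using Nat.evenOddRec with
  | h0 => omega
  | h_even m ih => rw [binaryOnes_two_mul]; exact ih (by omega)
  | h_odd m ih => rw [binaryOnes_two_mul_add_one]; omega

theorem padicValNat_two_two_mul {m : ℕ} (hm : 0 < m) :
    padicValNat 2 (2 * m) = padicValNat 2 m + 1 := by
  rw [padicValNat.mul two_ne_zero hm.ne', padicValNat_self, add_comm]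

theorem padicValNat_two_two_mul_add_one (m : ℕ) : padicValNat 2 (2 * m + 1) = 0 :=
  padicValNat.eq_zero_of_not_dvd (by omega)

theorem padicValNat_two_pow_mul (i : ℕ) {m : ℕ} (hm : 0 < m) :
    padicValNat 2 (2 ^ i * m) = padicValNat 2 m + i := by
  rw [padicValNat.mul (by positivity) hm.ne', padicValNat.prime_pow, add_comm]

theorem binaryOnes_two_pow_mul (i m : ℕ) : binaryOnes (2 ^ i * m) = binaryOnes m := by
  induction i with
  | zero => simp
  | succ i ih => rw [pow_succ', mul_assoc, binaryOnes_two_mul, ih]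

theorem two_pow_succ_sub_one (a : ℕ) : 2 ^ (a + 1) - 1 = 2 * (2 ^ a - 1) + 1 := by
  have := Nat.two_pow_pos a
  rw [pow_succ']
  omega

theorem binaryOnes_two_pow_mul_add (a m : ℕ) :
    binaryOnes (2 ^ a * m + (2 ^ a - 1)) = binaryOnes m + a := by
  induction a with
  | zero => simp
  | succ a ih =>
    rw [two_pow_succ_sub_one, pow_succ', mul_assoc, ← add_assoc, ← mul_add,
      binaryOnes_two_mul_add_one, ih, add_assoc]

theorem binaryOnes_two_pow_sub_one (a : ℕ) : binaryOnes (2 ^ a - 1) = a := by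
  simpa [binaryOnes_zero] using binaryOnes_two_pow_mul_add a 0

theorem binaryOnes_two_pow (i : ℕ) : binaryOnes (2 ^ i) = 1 := by
  simpa [binaryOnes_zero] using (binaryOnes_two_pow_mul i 1).trans (binaryOnes_two_mul_add_one 0)

/-- Equality of digit sums means that no carry occurs, so `m` has only zeroes below the block of `a`
ones. -/
theorem two_pow_dvd_of_binaryOnes_add (a m : ℕ)
    (h : binaryOnes (2 ^ a - 1) + binaryOnes m = binaryOnes (2 ^ a - 1 + m)) : 2 ^ a ∣ m := by
  induction a generalizing m with
  | zero => simp
  | succ a ih =>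
    rw [two_pow_succ_sub_one] at h
    obtain ⟨k, rfl | rfl⟩ := Nat.even_or_odd' m
    · rw [add_right_comm, ← mul_add, binaryOnes_two_mul_add_one, binaryOnes_two_mul_add_one,
        binaryOnes_two_mul] at h
      rw [pow_succ']
      exact mul_dvd_mul_left 2 (ih k (by omega))
    · have h1 := binaryOnes_add_le (2 ^ a - 1) (k + 1)
      have h2 := binaryOnes_add_le k 1
      have h3 := binaryOnes_two_pow 0
      rw [show 2 * (2 ^ a - 1) + 1 + (2 * k + 1) = 2 * (2 ^ a - 1 + (k + 1)) by ring,
        binaryOnes_two_mul_add_one, binaryOnes_two_mul_add_one, binaryOnes_two_mul] at h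
      rw [pow_zero] at h3
      omega

/-! ### Numbers whose ones precede their zeroes -/

/-- In the binary expansion of `n`, which is nonzero, all ones precede all zeroes. -/
def OnesThenZeroes (n : ℕ) : Prop := ∃ i a, n = 2 ^ i * (2 ^ (a + 1) - 1)

theorem padicValNat_two_pow_mul_two_pow_sub_one (i a : ℕ) :
    padicValNat 2 (2 ^ i * (2 ^ (a + 1) - 1)) = i := by
  rw [two_pow_succ_sub_one, padicValNat_two_pow_mul _ (by omega),
    padicValNat_two_two_mul_add_one, zero_add]

theorem exists_eq_two_pow_mul_odd {n : ℕ} (hn : 0 < n) :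
    ∃ k, n = 2 ^ padicValNat 2 n * (2 * k + 1) := by
  obtain ⟨q, hq⟩ := pow_padicValNat_dvd (p := 2) (n := n)
  obtain ⟨k, rfl | rfl⟩ := Nat.even_or_odd' q
  · exact absurd ⟨k, by rw [pow_succ, mul_assoc]; exact hq⟩ (pow_succ_padicValNat_not_dvd hn.ne')
  · exact ⟨k, hq⟩

theorem eq_two_pow_of_binaryOnes_eq_one {n : ℕ} (h : binaryOnes n = 1) :
    n = 2 ^ padicValNat 2 n := by
  have hn : n ≠ 0 := by rintro rfl; simp [binaryOnes_zero] at h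
  obtain ⟨k, hk⟩ := exists_eq_two_pow_mul_odd (Nat.pos_of_ne_zero hn)
  rw [hk, binaryOnes_two_pow_mul, binaryOnes_two_mul_add_one] at h
  rcases Nat.eq_zero_or_pos k with rfl | hk0
  · simpa using hk
  · have := binaryOnes_pos hk0
    omega

theorem OnesThenZeroes.two_pow (i : ℕ) : OnesThenZeroes (2 ^ i) := ⟨i, 0, by simp⟩

theorem two_pow_dvd_of_ones_add {i a m n : ℕ} (hn : n = 2 ^ i * (2 ^ a - 1) + m)
    (hi : 2 ^ i ∣ m)
    (h : binaryOnes (2 ^ i * (2 ^ a - 1)) + binaryOnes m = binaryOnes n) :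
    2 ^ (i + a) ∣ m := by
  obtain ⟨k, rfl⟩ := hi
  rw [hn, ← mul_add, binaryOnes_two_pow_mul, binaryOnes_two_pow_mul,
    binaryOnes_two_pow_mul] at h
  rw [pow_add]
  exact mul_dvd_mul_left _ (two_pow_dvd_of_binaryOnes_add a k h)

theorem padicValNat_two_lt_of_dvd {i n : ℕ} (hn : 0 < n) (h : 2 ^ (i + 1) ∣ n) :
    i < padicValNat 2 n :=
  (padicValNat_dvd_iff_le hn.ne').1 h

theorem padicValNat_two_add_of_lt {j m : ℕ} (hm : 0 < m)
    (h : padicValNat 2 m < padicValNat 2 j) : padicValNat 2 (j + m) = padicValNat 2 m := by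
  obtain ⟨a, ha⟩ : 2 ^ (padicValNat 2 m + 1) ∣ j := (pow_dvd_pow 2 h).trans pow_padicValNat_dvd
  obtain ⟨b, hb⟩ := exists_eq_two_pow_mul_odd hm
  set i := padicValNat 2 m
  rw [ha, hb, show 2 ^ (i + 1) * a + 2 ^ i * (2 * b + 1) = 2 ^ i * (2 * (a + b) + 1) by ring,
    padicValNat_two_pow_mul _ (by omega), padicValNat_two_two_mul_add_one, zero_add]

theorem padicValNat_two_lt_add_of_eq {j m : ℕ} (hj : 0 < j) (hm : 0 < m)
    (h : padicValNat 2 j = padicValNat 2 m) : padicValNat 2 m < padicValNat 2 (j + m) := by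
  obtain ⟨a, ha⟩ := exists_eq_two_pow_mul_odd hj
  obtain ⟨b, hb⟩ := exists_eq_two_pow_mul_odd hm
  refine padicValNat_two_lt_of_dvd (by omega) ⟨a + b + 1, ?_⟩
  rw [h] at ha
  rw [pow_succ]
  linear_combination ha + hb

/-- A block of ones directly above a block of ones, added without carries: the lower one is a
single digit. -/
theorem OnesThenZeroes.add {j m : ℕ} (hj : OnesThenZeroes j) (hm : OnesThenZeroes m)
    (hv : padicValNat 2 j = padicValNat 2 m + 1)
    (hs : binaryOnes j + binaryOnes m = binaryOnes (j + m)) :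
    OnesThenZeroes (j + m) ∧ m = 2 ^ padicValNat 2 (j + m) := by
  obtain ⟨i, a, rfl⟩ := hj
  obtain ⟨k, b, rfl⟩ := hm
  rw [padicValNat_two_pow_mul_two_pow_sub_one, padicValNat_two_pow_mul_two_pow_sub_one] at hv
  subst hv
  -- The upper block must be divisible by 2^(k + b + 1), but its valuation is k + 1; hence b = 0.
  have h1 := two_pow_dvd_of_ones_add (i := k) (a := b + 1)
    (m := 2 ^ (k + 1) * (2 ^ (a + 1) - 1)) (add_comm _ _)
    ⟨2 * (2 ^ (a + 1) - 1), by rw [pow_succ 2 k, mul_assoc]⟩ (by rw [← hs, add_comm])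
  have hb : b = 0 := by
    have h2 := (padicValNat_dvd_iff_le (p := 2) (by
      have := Nat.two_pow_pos (a+1)
      rw [two_pow_succ_sub_one]; positivity)).1 h1
    rw [padicValNat_two_pow_mul_two_pow_sub_one] at h2
    omega
  subst hb
  have h3 : 2 ^ (k + 1) * (2 ^ (a + 1) - 1) + 2 ^ k * (2 ^ (0 + 1) - 1) =
      2 ^ k * (2 ^ (a + 1 + 1) - 1) := by
    rw [two_pow_succ_sub_one (a + 1)]
    ring
  rw [h3, padicValNat_two_pow_mul_two_pow_sub_one]
  exact ⟨⟨k, a + 1, rfl⟩, by simp⟩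

theorem OnesThenZeroes.exists_of_ne_two_pow {n : ℕ} (hn : OnesThenZeroes n)
    (h : n ≠ 2 ^ padicValNat 2 n) : ∃ j, n = j + 2 ^ padicValNat 2 n ∧ OnesThenZeroes j ∧
      padicValNat 2 j = padicValNat 2 n + 1 ∧ binaryOnes j + 1 = binaryOnes n := by
  obtain ⟨i, a, rfl⟩ := hn
  rw [padicValNat_two_pow_mul_two_pow_sub_one] at *
  cases a with
  | zero => simp at h
  | succ a =>
    refine ⟨2 ^ (i + 1) * (2 ^ (a + 1) - 1), ?_, ⟨_, _, rfl⟩,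
      padicValNat_two_pow_mul_two_pow_sub_one _ _, ?_⟩
    · rw [two_pow_succ_sub_one (a + 1)]
      ring
    · simp only [binaryOnes_two_pow_mul, binaryOnes_two_pow_sub_one]

theorem binaryOnes_sub_two_pow {n m : ℕ} (hn : n = 2 ^ padicValNat 2 n + m) :
    binaryOnes n = binaryOnes m + 1 := by
  rcases Nat.eq_zero_or_pos m with rfl | hm
  · rw [hn, add_zero, binaryOnes_two_pow, binaryOnes_zero]
  obtain ⟨k, hk⟩ := exists_eq_two_pow_mul_odd (n := n) (by rw [hn]; positivity)
  set i := padicValNat 2 n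
  have : m = 2 ^ i * (2 * k) := by
    have : 2 ^ i * (2 * k + 1) = 2 ^ i * (2 * k) + 2 ^ i := by ring
    omega
  rw [this, hk]
  simp only [binaryOnes_two_pow_mul, binaryOnes_two_mul, binaryOnes_two_mul_add_one]

/-! ### Residues modulo 2 of scaled rationals -/

/-- `x / 2 ^ e` is a 2-adic integer, with residue `b` modulo 2. -/
def HasResidue (e : ℤ) (x : ℚ) (b : ZMod 2) : Prop :=
  ∃ m k : ℤ, Odd k ∧ x * k = 2 ^ e * m ∧ (m : ZMod 2) = b

theorem odd_intCast_zmod_two {k : ℤ} (hk : Odd k) : (k : ZMod 2) = 1 := by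
  obtain ⟨r, rfl⟩ := hk
  push_cast
  rw [show (2 : ZMod 2) = 0 from rfl]
  ring

namespace HasResidue

theorem zero (e : ℤ) : HasResidue e 0 0 := ⟨0, 1, odd_one, by simp, by simp⟩

theorem one : HasResidue 0 1 1 := ⟨1, 1, odd_one, by simp, by simp⟩

theorem two : HasResidue 1 2 1 := ⟨1, 1, odd_one, by simp, by simp⟩

theorem add {e : ℤ} {x y : ℚ} {a b : ZMod 2} (hx : HasResidue e x a) (hy : HasResidue e y b) :
    HasResidue e (x + y) (a + b) := by
  obtain ⟨m, k, hk, h, rfl⟩ := hx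
  obtain ⟨m', k', hk', h', rfl⟩ := hy
  refine ⟨m * k' + m' * k, k * k', hk.mul hk', ?_, ?_⟩
  · push_cast
    linear_combination k' * h + k * h'
  · simp [odd_intCast_zmod_two hk, odd_intCast_zmod_two hk']

theorem neg {e : ℤ} {x : ℚ} {a : ZMod 2} (hx : HasResidue e x a) : HasResidue e (-x) a := by
  obtain ⟨m, k, hk, h, rfl⟩ := hx
  refine ⟨-m, k, hk, ?_, ?_⟩
  · push_cast
    linear_combination -h
  · push_cast
    exact ZMod.neg_eq_self_mod_two _

theorem mul {e f : ℤ} {x y : ℚ} {a b : ZMod 2} (hx : HasResidue e x a) (hy : HasResidue f y b) :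
    HasResidue (e + f) (x * y) (a * b) := by
  obtain ⟨m, k, hk, h, rfl⟩ := hx
  obtain ⟨m', k', hk', h', rfl⟩ := hy
  refine ⟨m * m', k * k', hk.mul hk', ?_, by push_cast; rfl⟩
  rw [zpow_add₀ two_ne_zero]
  push_cast
  linear_combination y * k' * h + 2 ^ e * m * h'

theorem of_lt {e f : ℤ} {x : ℚ} {a : ZMod 2} (hx : HasResidue e x a) (h : f < e) :
    HasResidue f x 0 := by
  obtain ⟨m, k, hk, hm, rfl⟩ := hx
  obtain ⟨r, rfl⟩ : ∃ r : ℕ, e = f + (r + 1 : ℕ) := ⟨(e - f - 1).toNat, by omega⟩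
  refine ⟨2 ^ (r + 1) * m, k, hk, ?_, ?_⟩
  · rw [hm, zpow_add₀ two_ne_zero, zpow_natCast]
    push_cast
    ring
  · push_cast
    rw [show (2 : ZMod 2) = 0 from rfl]
    simp

theorem sum {ι : Type*} {s : Finset ι} {e : ℤ} {x : ι → ℚ} {a : ι → ZMod 2}
    (h : ∀ i ∈ s, HasResidue e (x i) (a i)) : HasResidue e (∑ i ∈ s, x i) (∑ i ∈ s, a i) := by
  classical
  induction s using Finset.induction_on with
  | empty => simpa using zero e
  | insert i s hi ih =>
    rw [Finset.sum_insert hi, Finset.sum_insert hi]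
    exact (h i (Finset.mem_insert_self i s)).add
      (ih fun j hj => h j (Finset.mem_insert_of_mem hj))

theorem natCast {n : ℕ} (hn : 0 < n) : HasResidue (padicValNat 2 n) n 1 := by
  obtain ⟨k, hk⟩ := exists_eq_two_pow_mul_odd hn
  refine ⟨2 * k + 1, 1, odd_one, ?_, odd_intCast_zmod_two ⟨k, rfl⟩⟩
  rw [zpow_natCast, Int.cast_one, mul_one]
  exact_mod_cast hk

theorem of_natCast_mul {e : ℤ} {x : ℚ} {a : ZMod 2} {n : ℕ} (hn : 0 < n)
    (h : HasResidue (e + padicValNat 2 n) (n * x) a) : HasResidue e x a := by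
  obtain ⟨m, k, hk, hm, rfl⟩ := h
  obtain ⟨r, hr⟩ := exists_eq_two_pow_mul_odd hn
  refine ⟨m, (2 * r + 1) * k, Odd.mul ⟨r, rfl⟩ hk, ?_, rfl⟩
  have h2 : (2 : ℚ) ^ padicValNat 2 n ≠ 0 := by positivity
  have hr' : (n : ℚ) = 2 ^ padicValNat 2 n * (2 * r + 1) := by exact_mod_cast hr
  rw [zpow_add₀ two_ne_zero, zpow_natCast] at hm
  apply mul_left_cancel₀ h2
  push_cast
  linear_combination hm - x * k * hr'

theorem le_padicValNat {e N : ℕ} (hN : 0 < N) {a : ZMod 2} (h : HasResidue e N a) :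
    e ≤ padicValNat 2 N ∧ (padicValNat 2 N = e ↔ a = 1) := by
  obtain ⟨m, k, hk, hm, rfl⟩ := h
  obtain ⟨r, hr⟩ := exists_eq_two_pow_mul_odd hN
  have hr' : (N : ℚ) = 2 ^ padicValNat 2 N * (2 * r + 1) := by exact_mod_cast hr
  have h1 : (2 : ℤ) ^ padicValNat 2 N * ((2 * r + 1) * k) = 2 ^ e * m := by
    rw [hr', zpow_natCast] at hm
    have : (((2 : ℤ) ^ padicValNat 2 N * ((2 * r + 1) * k) : ℤ) : ℚ) = (2 ^ e * m : ℤ) := by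
      push_cast
      linear_combination hm
    exact_mod_cast this
  have hodd : Odd ((2 * r + 1) * k) := Odd.mul ⟨r, rfl⟩ hk
  generalize (2 * r + 1) * k = q at h1 hodd
  generalize padicValNat 2 N = v at h1
  have hle : e ≤ v := by
    by_contra! hlt
    obtain ⟨s, rfl⟩ : ∃ s, e = v + (s + 1) := ⟨e - v - 1, by omega⟩
    rw [pow_add, mul_assoc] at h1
    have h2 := mul_left_cancel₀ (by positivity) h1
    rw [h2, pow_succ', mul_assoc] at hodd
    exact (Int.not_even_iff_odd.2 hodd) (even_two_mul _)
  obtain ⟨s, rfl⟩ := Nat.exists_eq_add_of_le hle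
  rw [pow_add, mul_assoc] at h1
  have h2 := mul_left_cancel₀ (by positivity) h1
  refine ⟨hle, ?_⟩
  rw [← h2]
  push_cast
  rw [odd_intCast_zmod_two hodd, mul_one]
  cases s with
  | zero => simp
  | succ s =>
    rw [show (2 : ZMod 2) = 0 from rfl]
    simp

end HasResidue

/-! ### Residues through the two recurrences -/

open scoped Classical in
/-- The residues of the logarithmic derivative of `∑ xⁿ / n!²`, from its Riccati equation. -/
theorem hasResidue_logDeriv {l : ℕ → ℚ} (h0 : l 0 = 0)
    (hl : ∀ n, 0 < n → n * l n =
      (if n = 1 then 1 else 0) - ∑ p ∈ antidiagonal n, l p.1 * l p.2)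
    (n : ℕ) (hn : 0 < n) :
    HasResidue (4 * binaryOnes n - 2 + padicValNat 2 n - 2 * n) (l n)
      (if OnesThenZeroes n then 1 else 0) := by
  induction n using Nat.strong_induction_on with | _ n ih
  apply HasResidue.of_natCast_mul hn
  rw [hl n hn]
  -- The second ν(n) accounts for the factor n on the left of the recurrence.
  set e : ℤ := 4 * binaryOnes n - 2 + padicValNat 2 n - 2 * n + padicValNat 2 n with he
  -- `R` picks one of the two orders of each off-diagonal pair: the second entry has the smaller
  -- valuation, ties being broken by size.
  set R : ℕ × ℕ → Prop := fun p => padicValNat 2 p.2 < padicValNat 2 p.1 ∨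
    (padicValNat 2 p.2 = padicValNat 2 p.1 ∧ p.2 < p.1) with hR
  have hsplit : ∑ p ∈ antidiagonal n, l p.1 * l p.2 =
      ∑ p ∈ antidiagonal n, (if R p then 2 * (l p.1 * l p.2) else 0) +
      ∑ p ∈ antidiagonal n, (if p.1 = p.2 then l p.1 * l p.2 else 0) := by
    have h1 : ∀ p : ℕ × ℕ, l p.1 * l p.2 = (if R p then l p.1 * l p.2 else 0) +
        (if R p.swap then l p.swap.1 * l p.swap.2 else 0) +
        (if p.1 = p.2 then l p.1 * l p.2 else 0) := by
      rintro ⟨i, j⟩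
      simp only [hR, Prod.fst_swap, Prod.snd_swap]
      rcases lt_trichotomy (padicValNat 2 i) (padicValNat 2 j) with h | h | h
      · have : i ≠ j := by rintro rfl; exact h.ne rfl
        simp [h, h.not_gt, h.ne', this, mul_comm]
      · rcases lt_trichotomy i j with h' | h' | h'
        · simp [h, h', h'.not_gt, h'.ne, mul_comm]
        · simp [h']
        · simp [h, h', h'.not_gt, h'.ne']
      · have : i ≠ j := by rintro rfl; exact h.ne rfl
        simp [h, h.not_gt, h.ne', this]
    rw [Finset.sum_congr rfl fun p _ => h1 p, Finset.sum_add_distrib, Finset.sum_add_distrib,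
      Finset.Nat.sum_antidiagonal_swap (n := n) (f := fun p => if R p then l p.1 * l p.2 else 0),
      ← two_mul, Finset.mul_sum]
    simp only [mul_ite, mul_zero]
  have hA : HasResidue e
      (∑ p ∈ antidiagonal n, (if R p then 2 * (l p.1 * l p.2) else 0))
      (∑ p ∈ antidiagonal n,
        (if OnesThenZeroes n ∧ p.2 = 2 ^ padicValNat 2 n ∧ p.1 ≠ 0 then 1 else 0)) := by
    refine HasResidue.sum ?_
    rintro ⟨i, j⟩ hp
    obtain rfl : i + j = n := mem_antidiagonal.1 hp
    have hex : OnesThenZeroes (i + j) ∧ j = 2 ^ padicValNat 2 (i + j) ∧ i ≠ 0 →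
        OnesThenZeroes i ∧ OnesThenZeroes j ∧ padicValNat 2 i = padicValNat 2 j + 1 ∧
        binaryOnes i + binaryOnes j = binaryOnes (i + j) := by
      rintro ⟨h1, h2, h3⟩
      obtain ⟨i', h4, h5, h6, h7⟩ := h1.exists_of_ne_two_pow (by omega)
      obtain rfl : i' = i := by omega
      have h8 : binaryOnes j = 1 := by rw [h2, binaryOnes_two_pow]
      have h9 : padicValNat 2 j = padicValNat 2 (i' + j) := by
        conv_lhs => rw [h2, padicValNat.prime_pow]
      exact ⟨h5, h2 ▸ OnesThenZeroes.two_pow _, by omega, by omega⟩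
    rcases Nat.eq_zero_or_pos i with rfl | hi
    · simpa [h0] using HasResidue.zero e
    rcases Nat.eq_zero_or_pos j with rfl | hj
    · have : (0 : ℕ) ≠ 2 ^ padicValNat 2 i := (Nat.two_pow_pos _).ne
      simpa [h0, this] using HasResidue.zero e
    have hx := HasResidue.two.mul ((ih i (by omega) hi).mul (ih j (by omega) hj))
    have hs := binaryOnes_add_le i j
    rcases lt_trichotomy (padicValNat 2 j) (padicValNat 2 i) with h | h | h
    · have hv := padicValNat_two_add_of_lt hj h
      have hRp : R (i, j) := Or.inl h
      -- The exponent of 2·l_i·l_j exceeds `e` by 4(s(i) + s(j) - s(n)) + ν(i) - ν(j) - 1, which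
      -- vanishes exactly under this condition.
      by_cases hc : binaryOnes i + binaryOnes j = binaryOnes (i + j) ∧
          padicValNat 2 i = padicValNat 2 j + 1
      · have hiff : (OnesThenZeroes (i + j) ∧ j = 2 ^ padicValNat 2 (i + j) ∧ i ≠ 0) ↔
            (OnesThenZeroes i ∧ OnesThenZeroes j) := by
          refine ⟨fun hh => ⟨(hex hh).1, (hex hh).2.1⟩, fun hh => ?_⟩
          have := hh.1.add hh.2 hc.2 hc.1
          exact ⟨this.1, this.2, hi.ne'⟩
        simp only [hRp, if_true, hiff]
        convert hx using 1
        · rw [he]; omega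
        · by_cases ha : OnesThenZeroes i <;> by_cases hb : OnesThenZeroes j <;> simp [ha, hb]
      · have hnot : ¬(OnesThenZeroes (i + j) ∧ j = 2 ^ padicValNat 2 (i + j) ∧ i ≠ 0) :=
          fun hh => hc ⟨(hex hh).2.2.2, (hex hh).2.2.1⟩
        simp only [hRp, if_true, hnot, if_false]
        refine hx.of_lt ?_
        rw [he]
        omega
    -- For equal valuations, the carry bound makes the excess at least 2(ν(n) - ν(i)) - 1 > 0.
    · have hv := padicValNat_two_lt_add_of_eq hi hj h.symm
      have hv2 := padicValNat_add_binaryOnes_add_le hi j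
      have hnot : ¬(OnesThenZeroes (i + j) ∧ j = 2 ^ padicValNat 2 (i + j) ∧ i ≠ 0) :=
        fun hh => by have := (hex hh).2.2.1; omega
      simp only [hnot, if_false]
      split_ifs
      · refine hx.of_lt ?_
        rw [he]
        omega
      · exact HasResidue.zero e
    · have hRp : ¬ R (i, j) := by simp only [hR]; omega
      have hnot : ¬(OnesThenZeroes (i + j) ∧ j = 2 ^ padicValNat 2 (i + j) ∧ i ≠ 0) :=
        fun hh => by have := (hex hh).2.2.1; omega
      simp only [hRp, hnot, if_false]
      exact HasResidue.zero e
  have hAsum : (∑ p ∈ antidiagonal n,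
      (if OnesThenZeroes n ∧ p.2 = 2 ^ padicValNat 2 n ∧ p.1 ≠ 0 then 1 else 0) : ZMod 2) =
      if OnesThenZeroes n ∧ n ≠ 2 ^ padicValNat 2 n then 1 else 0 := by
    have hle : 2 ^ padicValNat 2 n ≤ n := Nat.le_of_dvd hn pow_padicValNat_dvd
    rw [Finset.sum_eq_single (n - 2 ^ padicValNat 2 n, 2 ^ padicValNat 2 n)]
    · refine if_congr (and_congr_right fun _ => ?_) rfl rfl
      simp only [true_and]
      omega
    · rintro ⟨i, j⟩ hp hne
      rw [mem_antidiagonal] at hp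
      refine if_neg fun hh => hne ?_
      ext <;> simp only at * <;> omega
    · intro hh
      exact absurd (mem_antidiagonal.2 (by simp only; omega)) hh
  have hB : HasResidue e
      (∑ p ∈ antidiagonal n, (if p.1 = p.2 then l p.1 * l p.2 else 0))
      (if n = 2 ^ padicValNat 2 n ∧ n ≠ 1 then 1 else 0) := by
    obtain ⟨h, rfl | rfl⟩ := Nat.even_or_odd' n
    · have hh : 0 < h := by omega
      rw [Finset.sum_eq_single (h, h)]
      · have hx := (ih h (by omega) hh).mul (ih h (by omega) hh)
        rw [padicValNat_two_two_mul hh, binaryOnes_two_mul] at he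
        simp only [if_true]
        have h1 := binaryOnes_pos hh
        -- The square of l_h exceeds `e` by 4(s(h) - 1), so it counts only when n = 2h is a power of
        -- two.
        by_cases hs : binaryOnes h = 1
        · have h2 := eq_two_pow_of_binaryOnes_eq_one hs
          have h3 : 2 * h = 2 ^ padicValNat 2 (2 * h) ∧ 2 * h ≠ 1 := by
            rw [padicValNat_two_two_mul hh, pow_succ', ← h2]
            omega
          have h4 : OnesThenZeroes h := h2 ▸ OnesThenZeroes.two_pow _
          rw [if_pos h3]
          rw [if_pos h4, mul_one] at hx
          convert hx using 1
          rw [he]; omega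
        · have h3 : ¬(2 * h = 2 ^ padicValNat 2 (2 * h) ∧ 2 * h ≠ 1) := by
            rintro ⟨h4, -⟩
            have h5 := congrArg binaryOnes h4
            rw [binaryOnes_two_pow, binaryOnes_two_mul] at h5
            exact hs h5
          rw [if_neg h3]
          refine hx.of_lt ?_
          rw [he]; omega
      · rintro ⟨i, j⟩ hp hne
        rw [mem_antidiagonal] at hp
        refine if_neg fun hh => hne ?_
        ext <;> simp only at * <;> omega
      · intro hh
        exact absurd (mem_antidiagonal.2 (by simp only; omega)) hh
    · rw [padicValNat_two_two_mul_add_one, Finset.sum_eq_zero]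
      · rw [if_neg (by omega)]
        exact HasResidue.zero e
      · rintro ⟨i, j⟩ hp
        rw [mem_antidiagonal] at hp
        exact if_neg (by simp only at *; omega)
  have hC : HasResidue e (if n = 1 then 1 else 0) (if n = 1 then 1 else 0) := by
    by_cases h1 : n = 1
    · subst h1
      have : e = 0 := by
        have h2 := binaryOnes_two_pow 0
        rw [pow_zero] at h2
        simp [he, h2]
      simpa [this] using HasResidue.one
    · simpa [h1] using HasResidue.zero e
  rw [hAsum] at hA
  rw [hsplit, sub_eq_add_neg]
  convert hC.add (hA.add hB).neg using 1
  -- The three sources are disjoint: n = 1 from the linear term, other powers of two from the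
  -- square, longer blocks from the off-diagonal pairs.
  by_cases h1 : n = 1
  · have : OnesThenZeroes n := h1 ▸ OnesThenZeroes.two_pow 0
    subst h1
    simp [this]
  · by_cases h2 : n = 2 ^ padicValNat 2 n
    · have : OnesThenZeroes n := h2 ▸ OnesThenZeroes.two_pow _
      simp only [h1, this, ← h2]
      simp [h1]
    · simp [h1, h2]

open scoped Classical in
/-- The residues of a power, from those of the logarithmic derivative. -/
theorem hasResidue_pow_coeff {l g : ℕ → ℚ} {d : ℕ} (hd : 0 < d) (h0 : l 0 = 0) (g0 : g 0 = 1)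
    (hl : ∀ n, 0 < n → HasResidue (4 * binaryOnes n - 2 + padicValNat 2 n - 2 * n) (l n)
      (if OnesThenZeroes n then 1 else 0))
    (hg : ∀ n, 0 < n → n * g n = d * ∑ p ∈ antidiagonal n, l p.1 * g p.2)
    {e : ℕ → ℤ} {t : ℕ → ZMod 2} (e0 : e 0 = 0) (t0 : t 0 = 1)
    (he : ∀ i j, 0 < i → e (i + j) + padicValNat 2 (i + j) ≤ padicValNat 2 d +
      (4 * binaryOnes i - 2 + padicValNat 2 i - 2 * i) + e j)
    (ht : ∀ n, 0 < n → ∑ p ∈ antidiagonal n, (if 0 < p.1 ∧ OnesThenZeroes p.1 ∧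
      e n + padicValNat 2 n = padicValNat 2 d +
        (4 * binaryOnes p.1 - 2 + padicValNat 2 p.1 - 2 * p.1) + e p.2 then t p.2 else 0) = t n)
    (n : ℕ) : HasResidue (e n) (g n) (t n) := by
  induction n using Nat.strong_induction_on with | _ n ih
  rcases Nat.eq_zero_or_pos n with rfl | hn
  · rw [e0, g0, t0]
    exact HasResidue.one
  apply HasResidue.of_natCast_mul hn
  rw [hg n hn, ← ht n hn, Finset.mul_sum]
  refine HasResidue.sum ?_
  rintro ⟨i, j⟩ hp
  obtain rfl : i + j = n := mem_antidiagonal.1 hp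
  rcases Nat.eq_zero_or_pos i with rfl | hi
  · simpa [h0] using HasResidue.zero _
  have hx := (HasResidue.natCast hd).mul ((hl i hi).mul (ih j (by omega)))
  have hij := he i j hi
  -- Only terms whose exponent attains the bound can contribute to the residue.
  rcases hij.eq_or_lt with h | h
  · rw [add_assoc] at h
    simp only [hi, true_and, add_assoc, ← h]
    rw [h]
    convert hx using 1
    by_cases h1 : OnesThenZeroes i <;> simp [h1]
  · simp only [h.ne, and_false, if_false]
    refine hx.of_lt ?_
    linarith

/-! ### Binary expansions without adjacent ones -/

theorem concat_suffix_concat {α : Type*} {l l' : List α} {x y : α} :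
    l ++ [x] <:+ l' ++ [y] ↔ x = y ∧ l <:+ l' := by
  rw [← List.reverse_prefix, List.reverse_concat, List.reverse_concat, List.cons_prefix_cons,
    List.reverse_prefix]

/-- The binary expansion of `n` has no two adjacent ones. -/
def NoAdjacentOnes (n : ℕ) : Prop := ¬ [1, 1] <:+: binaryExpansion n

theorem noAdjacentOnes_zero : NoAdjacentOnes 0 := by
  simp [NoAdjacentOnes, binaryExpansion]

theorem noAdjacentOnes_two_mul (m : ℕ) : NoAdjacentOnes (2 * m) ↔ NoAdjacentOnes m := by
  rcases eq_or_ne m 0 with rfl | hm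
  · rfl
  · rw [NoAdjacentOnes, binaryExpansion_two_mul hm, List.infix_concat_iff, NoAdjacentOnes,
      show ([1, 1] : List ℕ) = [1] ++ [1] from rfl, concat_suffix_concat]
    simp

theorem noAdjacentOnes_two_pow_mul (i m : ℕ) :
    NoAdjacentOnes (2 ^ i * m) ↔ NoAdjacentOnes m := by
  induction i with
  | zero => simp
  | succ i ih => rw [pow_succ', mul_assoc, noAdjacentOnes_two_mul, ih]

theorem singleton_one_suffix_binaryExpansion (m : ℕ) : [1] <:+ binaryExpansion m ↔ Odd m := by
  obtain ⟨k, rfl | rfl⟩ := Nat.even_or_odd' m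
  · rcases eq_or_ne k 0 with rfl | hk
    · simp [binaryExpansion]
    · rw [binaryExpansion_two_mul hk, ← List.nil_append [1], concat_suffix_concat]
      simp
  · rw [binaryExpansion_two_mul_add_one, ← List.nil_append [1], ← List.append_assoc,
      concat_suffix_concat]
    simp

theorem noAdjacentOnes_two_mul_add_one (m : ℕ) :
    NoAdjacentOnes (2 * m + 1) ↔ NoAdjacentOnes m ∧ Even m := by
  rw [NoAdjacentOnes, binaryExpansion_two_mul_add_one, List.infix_concat_iff, NoAdjacentOnes,
    ← Nat.not_odd_iff_even, ← singleton_one_suffix_binaryExpansion,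
    show ([1, 1] : List ℕ) = [1] ++ [1] from rfl, concat_suffix_concat]
  simp [and_comm]

-- For q = 2r + 1 the term a = 0 tests r, and by induction the remaining terms add the same value
-- again when r is odd. Modulo 2 these cancel, leaving the test of r for even r, which is the
-- recursion for adjacent ones. `N` merely bounds the length of the final run of ones.
open scoped Classical in
theorem sum_noAdjacentOnes_div (N q : ℕ) (hq : q ≤ N) :
    (∑ a ∈ Finset.range N, if q % 2 ^ (a + 1) = 2 ^ (a + 1) - 1 then
      (if NoAdjacentOnes (q / 2 ^ (a + 1)) then 1 else 0) else 0 : ZMod 2) =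
    if Odd q ∧ NoAdjacentOnes q then 1 else 0 := by
  induction N generalizing q with
  | zero => obtain rfl : q = 0 := by omega
            simp
  | succ N ih =>
    obtain ⟨r, rfl | rfl⟩ := Nat.even_or_odd' q
    · rw [Finset.sum_eq_zero, if_neg]
      · rintro ⟨h, -⟩
        exact (Nat.not_odd_iff_even.2 (even_two_mul r)) h
      · intro a _
        refine if_neg fun h => ?_
        rw [two_pow_succ_sub_one, pow_succ', Nat.mul_mod_mul_left] at h
        omega
    · have hstep : ∀ a, (2 * r + 1) % 2 ^ (a + 1) = 2 * (r % 2 ^ a) + 1 ∧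
          (2 * r + 1) / 2 ^ (a + 1) = r / 2 ^ a := by
        intro a
        rw [pow_succ']
        constructor
        · rw [Nat.mod_mul, show (2 * r + 1) % 2 = 1 by omega,
            show (2 * r + 1) / 2 = r by omega, add_comm]
        · rw [← Nat.div_div_eq_div_mul, show (2 * r + 1) / 2 = r by omega]
      have hcond : ∀ a, (2 * r + 1) % 2 ^ (a + 1) = 2 ^ (a + 1) - 1 ↔ r % 2 ^ a = 2 ^ a - 1 := by
        intro a
        rw [(hstep a).1, two_pow_succ_sub_one]
        omega
      rw [Finset.sum_range_succ', if_congr (hcond 0) rfl rfl]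
      simp only [hcond, (hstep _).2]
      rw [ih r (by omega)]
      simp only [pow_zero, Nat.mod_one, Nat.div_one, noAdjacentOnes_two_mul_add_one]
      simp only [← Nat.not_odd_iff_even]
      by_cases h1 : Odd r <;> by_cases h2 : NoAdjacentOnes r <;> simp [h1, h2]; rfl

-- The selected pairs are the terms of minimal valuation when ν(d) = 2. Absence of carries makes
-- `p.1` a block at the low end of the lowest run of ones of n, and `p.2` what remains; dividing by
-- 2^ν(n) reduces to the odd case.
open scoped Classical in
theorem sum_noAdjacentOnes (n : ℕ) (hn : 0 < n) :
    (∑ p ∈ antidiagonal n, if 0 < p.1 ∧ OnesThenZeroes p.1 ∧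
      (padicValNat 2 p.1 = padicValNat 2 n ∧ binaryOnes p.1 + binaryOnes p.2 = binaryOnes n) then
      (if NoAdjacentOnes p.2 then 1 else 0) else 0 : ZMod 2) =
    if NoAdjacentOnes n then 1 else 0 := by
  obtain ⟨k, hk⟩ := exists_eq_two_pow_mul_odd hn
  set i := padicValNat 2 n
  set q := 2 * k + 1
  have hpos : ∀ a, 0 < 2 ^ a := Nat.two_pow_pos
  have key : ∀ a, q % 2 ^ (a + 1) = 2 ^ (a + 1) - 1 →
      q = 2 ^ (a + 1) * (q / 2 ^ (a + 1)) + (2 ^ (a + 1) - 1) := fun a ha => by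
    rw [← ha, Nat.div_add_mod]
  have hdiv : (if NoAdjacentOnes n then 1 else 0 : ZMod 2) =
      if Odd q ∧ NoAdjacentOnes q then 1 else 0 := by
    refine if_congr ?_ rfl rfl
    rw [hk, noAdjacentOnes_two_pow_mul]
    exact (and_iff_right ⟨k, rfl⟩).symm
  rw [hdiv, ← sum_noAdjacentOnes_div q q le_rfl, ← Finset.sum_filter,
    ← Finset.sum_filter (s := Finset.range q)]
  symm
  refine Finset.sum_nbij (fun a => (2 ^ i * (2 ^ (a + 1) - 1),
    2 ^ i * (2 ^ (a + 1) * (q / 2 ^ (a + 1))))) ?_ ?_ ?_ ?_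
  · intro a ha
    rw [Finset.mem_filter] at ha
    have hq := key a ha.2
    rw [Finset.mem_filter, mem_antidiagonal]
    refine ⟨?_, ?_, ⟨i, a, rfl⟩, padicValNat_two_pow_mul_two_pow_sub_one _ _, ?_⟩
    · rw [hk, ← mul_add, add_comm, ← hq]
    · rw [two_pow_succ_sub_one]
      have := hpos i
      positivity
    · rw [hk]
      simp only [binaryOnes_two_pow_mul, binaryOnes_two_pow_sub_one]
      conv_rhs => rw [hq, binaryOnes_two_pow_mul_add]
      rw [add_comm]
  · intro a _ b _ hab
    have h1 := congrArg (fun p : ℕ × ℕ => binaryOnes p.1) hab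
    simp only [binaryOnes_two_pow_mul, binaryOnes_two_pow_sub_one] at h1
    omega
  · rintro ⟨x, y⟩ hp
    simp only [Finset.coe_filter, Set.mem_ofPred_eq, mem_antidiagonal] at hp
    obtain ⟨hsum, hx, ⟨i', a, rfl⟩, hv, hs⟩ := hp
    rw [padicValNat_two_pow_mul_two_pow_sub_one] at hv
    subst hv
    have hy : 2 ^ i ∣ y := by
      refine (Nat.dvd_add_right (dvd_mul_right _ (2 ^ (a + 1) - 1))).1 ?_
      rw [hsum]
      exact pow_padicValNat_dvd
    obtain ⟨z, rfl⟩ := two_pow_dvd_of_ones_add hsum.symm hy hs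
    have hq : q = 2 ^ (a + 1) * z + (2 ^ (a + 1) - 1) := by
      apply Nat.eq_of_mul_eq_mul_left (hpos i)
      rw [← hk, ← hsum, pow_add, mul_assoc]
      ring
    have hlt : 2 ^ (a + 1) - 1 < 2 ^ (a + 1) := by have := hpos (a + 1); omega
    have hmod : q % 2 ^ (a + 1) = 2 ^ (a + 1) - 1 := by
      rw [hq, Nat.mul_add_mod, Nat.mod_eq_of_lt hlt]
    have hdv : q / 2 ^ (a + 1) = z := by
      rw [hq, Nat.mul_add_div (hpos _), Nat.div_eq_of_lt hlt, add_zero]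
    refine ⟨a, ?_, ?_⟩
    · simp only [Finset.coe_filter, Set.mem_ofPred_eq, Finset.mem_range]
      refine ⟨?_, hmod⟩
      have h1 : a < 2 ^ a := Nat.lt_two_pow_self
      have h2 : 2 ^ (a + 1) - 1 ≤ q := by rw [hq]; exact Nat.le_add_left _ _
      rw [two_pow_succ_sub_one] at h2
      omega
    · simp only [hdv, ← mul_assoc, ← pow_add]
  · intro a _
    simp only [noAdjacentOnes_two_pow_mul]

/-! ### The four cases of the valuation -/

theorem sum_antidiagonal_eq_two_pow {n : ℕ} (hn : 0 < n) {P : ℕ × ℕ → Prop} [DecidablePred P]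
    (hP : ∀ p ∈ antidiagonal n, P p ↔ p.1 = 2 ^ padicValNat 2 n) :
    (∑ p ∈ antidiagonal n, if P p then 1 else 0 : ZMod 2) = 1 := by
  have hle : 2 ^ padicValNat 2 n ≤ n := Nat.le_of_dvd hn pow_padicValNat_dvd
  have hmem : (2 ^ padicValNat 2 n, n - 2 ^ padicValNat 2 n) ∈ antidiagonal n :=
    mem_antidiagonal.2 (by simp only; omega)
  rw [Finset.sum_eq_single_of_mem _ hmem, if_pos ((hP _ hmem).2 rfl)]
  rintro ⟨i, j⟩ hp hne
  refine if_neg fun hh => hne ?_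
  have h1 := (hP _ hp).1 hh
  rw [mem_antidiagonal] at hp
  ext <;> simp only at * <;> omega

/-- The factorial contributes 2n - s(n), so a target valuation v for `N` corresponds to the exponent
v + s(n) - 2n for the coefficient. -/
theorem le_padicValNat_of_hasResidue {N n e v : ℕ} {g : ℚ} {a : ZMod 2} (hN : 0 < N)
    (hg : (N : ℚ) = (2 * n).factorial * g) (h : HasResidue ((e : ℤ) - 2 * n) g a)
    (hv : v + binaryOnes n = e) :
    v ≤ padicValNat 2 N ∧ (padicValNat 2 N = v ↔ a = 1) := by
  have h1 := (HasResidue.natCast (Nat.factorial_pos (2 * n))).mul h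
  have h2 := padicValNat_two_factorial (2 * n)
  rw [binaryOnes_two_mul] at h2
  rw [← hg, one_mul] at h1
  refine HasResidue.le_padicValNat hN (a := a) ?_
  convert h1 using 1
  omega

/-- These facts turn every comparison of exponents below into linear arithmetic. -/
theorem binaryOnes_conditions {i j : ℕ} (hi : 0 < i) :
    binaryOnes (i + j) ≤ binaryOnes i + binaryOnes j ∧
    padicValNat 2 (i + j) + binaryOnes (i + j) ≤
      padicValNat 2 i + binaryOnes i + binaryOnes j ∧ 0 < binaryOnes i ∧
    (i = 2 ^ padicValNat 2 (i + j) ↔ binaryOnes i = 1 ∧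
      padicValNat 2 i = padicValNat 2 (i + j) ∧
      binaryOnes (i + j) = binaryOnes i + binaryOnes j) := by
  refine ⟨binaryOnes_add_le i j, padicValNat_add_binaryOnes_add_le hi j, binaryOnes_pos hi,
    fun h => ?_, fun h => ?_⟩
  · have h1 : binaryOnes i = 1 := by rw [h, binaryOnes_two_pow]
    refine ⟨h1, ?_, ?_⟩
    · conv_lhs => rw [h, padicValNat.prime_pow]
    · rw [binaryOnes_sub_two_pow (n := i + j) (m := j) (by omega), h1, add_comm]
  · rw [← h.2.1]
    exact eq_two_pow_of_binaryOnes_eq_one h.1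

open scoped Classical in
theorem padicValNat_of_recurrence {l g : ℕ → ℚ} {d n N : ℕ} (hd : 0 < d) (hn : 0 < n)
    (hN : 0 < N) (hNg : (N : ℚ) = (2 * n).factorial * g n)
    (h0 : l 0 = 0) (g0 : g 0 = 1)
    (hl : ∀ n, 0 < n → n * l n =
      (if n = 1 then 1 else 0) - ∑ p ∈ antidiagonal n, l p.1 * l p.2)
    (hg : ∀ n, 0 < n → n * g n = d * ∑ p ∈ antidiagonal n, l p.1 * g p.2) :
    (padicValNat 2 d = 0 → padicValNat 2 N = binaryOnes n) ∧
    (padicValNat 2 d = 1 → padicValNat 2 N = 2 * binaryOnes n) ∧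
    (padicValNat 2 d = 2 → 3 * binaryOnes n ≤ padicValNat 2 N ∧
      (padicValNat 2 N = 3 * binaryOnes n ↔ NoAdjacentOnes n)) ∧
    (3 ≤ padicValNat 2 d → 3 * binaryOnes n + (padicValNat 2 d - 2) ≤ padicValNat 2 N ∧
      (padicValNat 2 N = 3 * binaryOnes n + (padicValNat 2 d - 2) ↔ OnesThenZeroes n)) := by
  have main := @hasResidue_pow_coeff l g d hd h0 g0 (hasResidue_logDeriv h0 hl) hg
  have hite : ∀ (P : Prop) [Decidable P], (if P then 1 else 0 : ZMod 2) = 1 ↔ P := by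
    intro P _
    by_cases h : P <;> simp [h]
  refine ⟨fun hv => ?_, fun hv => ?_, fun hv => ?_, fun hv => ?_⟩
  -- With c = s(i) + s(j) - s(n), the excess of a term is 2c + 2(s(i) - 1) + ν(i) - ν(n). Since ν(n)
  -- - ν(i) ≤ c, it is nonnegative and vanishes only for i = 2^ν(n).
  · have h := main (e := fun n => ((2 * binaryOnes n : ℕ) : ℤ) - 2 * n) (t := fun _ => 1)
      (by simp [binaryOnes_zero]) rfl ?_ ?_ n
    · exact (le_padicValNat_of_hasResidue hN hNg h (by ring)).2.2 rfl
    · intro i j hi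
      have := binaryOnes_conditions (j := j) hi
      omega
    · intro n hn
      refine sum_antidiagonal_eq_two_pow hn ?_
      rintro ⟨i, j⟩ hp
      obtain rfl : i + j = n := mem_antidiagonal.1 hp
      refine ⟨fun ⟨hi, _, h⟩ => ?_, fun h => ?_⟩
      · have := binaryOnes_conditions (j := j) hi
        simp only at *
        omega
      · have hi : 0 < i := by rw [show i = _ from h]; positivity
        have := binaryOnes_conditions (j := j) hi
        refine ⟨hi, (show i = _ from h) ▸ OnesThenZeroes.two_pow _, ?_⟩
        simp only at *
        omega
  -- Here the excess is 3c + (s(i) - 1) + ν(i) - ν(n), with the same zero.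
  · have h := main (e := fun n => ((3 * binaryOnes n : ℕ) : ℤ) - 2 * n) (t := fun _ => 1)
      (by simp [binaryOnes_zero]) rfl ?_ ?_ n
    · exact (le_padicValNat_of_hasResidue hN hNg h (by ring)).2.2 rfl
    · intro i j hi
      have := binaryOnes_conditions (j := j) hi
      omega
    · intro n hn
      refine sum_antidiagonal_eq_two_pow hn ?_
      rintro ⟨i, j⟩ hp
      obtain rfl : i + j = n := mem_antidiagonal.1 hp
      refine ⟨fun ⟨hi, _, h⟩ => ?_, fun h => ?_⟩
      · have := binaryOnes_conditions (j := j) hi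
        simp only at *
        omega
      · have hi : 0 < i := by rw [show i = _ from h]; positivity
        have := binaryOnes_conditions (j := j) hi
        refine ⟨hi, (show i = _ from h) ▸ OnesThenZeroes.two_pow _, ?_⟩
        simp only at *
        omega
  -- The excess is now 4c + ν(i) - ν(n): the size of s(i) no longer matters, so longer blocks
  -- contribute too.
  · have h := main (e := fun n => ((4 * binaryOnes n : ℕ) : ℤ) - 2 * n)
      (t := fun n => if NoAdjacentOnes n then 1 else 0)
      (by simp [binaryOnes_zero]) (by simp [noAdjacentOnes_zero]) ?_ ?_ n
    · have := le_padicValNat_of_hasResidue hN hNg h (v := 3 * binaryOnes n) (by ring)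
      rwa [hite] at this
    · intro i j hi
      have := binaryOnes_conditions (j := j) hi
      omega
    · intro n hn
      rw [← sum_noAdjacentOnes n hn]
      refine Finset.sum_congr rfl ?_
      rintro ⟨i, j⟩ hp
      obtain rfl : i + j = n := mem_antidiagonal.1 hp
      refine if_congr (and_congr_right fun hi => and_congr_right fun _ => ?_) rfl rfl
      have := binaryOnes_conditions (j := j) hi
      simp only at *
      omega
  -- The value at 0 is separate because g_0 = 1 lacks the extra ν(d) - 2. For j > 0 the excess is
  -- (ν(d) - 2) + 4c + ν(i) - ν(n) > 0, so only j = 0 contributes.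
  · have h := main (e := fun n => if n = 0 then 0 else
        ((4 * binaryOnes n + (padicValNat 2 d - 2) : ℕ) : ℤ) - 2 * n)
      (t := fun n => if n = 0 then 1 else if OnesThenZeroes n then 1 else 0)
      (by simp) (by simp) ?_ ?_ n
    · simp only [hn.ne', if_false] at h
      have := le_padicValNat_of_hasResidue hN hNg h
        (v := 3 * binaryOnes n + (padicValNat 2 d - 2)) (by ring)
      rwa [hite] at this
    · intro i j hi
      have := binaryOnes_conditions (j := j) hi
      rcases Nat.eq_zero_or_pos j with rfl | hj
      · simp only [add_zero, hi.ne', if_false, if_true]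
        omega
      · simp only [(add_pos hi hj).ne', hj.ne', if_false]
        omega
    · intro n hn
      have hmem : (n, 0) ∈ antidiagonal n := mem_antidiagonal.2 (add_zero n)
      rw [Finset.sum_eq_single_of_mem _ hmem]
      · simp only [hn.ne', if_false, if_true]
        refine if_congr ⟨fun h => h.2.1, fun h => ⟨hn, h, ?_⟩⟩ rfl rfl
        omega
      · rintro ⟨i, j⟩ hp hne
        obtain rfl : i + j = n := mem_antidiagonal.1 hp
        have hj : 0 < j := Nat.pos_of_ne_zero fun h => hne (by simp [h])
        refine if_neg fun ⟨hi, _, h⟩ => ?_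
        have := binaryOnes_conditions (j := j) hi
        simp only [(add_pos hi hj).ne', hj.ne', if_false] at *
        omega

/-! ### Translation to digit lists -/

theorem onesThenZeroes_iff {n : ℕ} (hn : 0 < n) : OnesThenZeroes n ↔
    ∃ a b : ℕ, binaryExpansion n = List.replicate a 1 ++ List.replicate b 0 := by
  constructor
  · rintro ⟨i, a, rfl⟩
    refine ⟨a + 1, i, ?_⟩
    induction i with
    | zero =>
      simp only [pow_zero, one_mul, List.replicate_zero, List.append_nil]
      clear hn
      induction a with
      | zero => simp [binaryExpansion]
      | succ a ih =>
        rw [two_pow_succ_sub_one, binaryExpansion_two_mul_add_one, ih,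
          ← List.replicate_succ']
    | succ i ih =>
      have h : 0 < 2 ^ i * (2 ^ (a + 1) - 1) := by
        rw [two_pow_succ_sub_one]
        positivity
      rw [pow_succ', mul_assoc, binaryExpansion_two_mul h.ne', ih h, List.append_assoc,
        ← List.replicate_succ']
  · rintro ⟨a, b, h⟩
    have h1 : ∀ a, Nat.ofDigits 2 (List.replicate a 1) = 2 ^ a - 1 := by
      intro a
      induction a with
      | zero => rfl
      | succ a ih => rw [List.replicate_succ, Nat.ofDigits_cons, ih, two_pow_succ_sub_one, add_comm]
    have h2 : n = 2 ^ b * (2 ^ a - 1) := by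
      rw [← Nat.ofDigits_digits 2 n, ← List.reverse_reverse (Nat.digits 2 n),
        ← binaryExpansion, h, List.reverse_append, List.reverse_replicate,
        List.reverse_replicate, Nat.ofDigits_append, h1]
      simp
    cases a with
    | zero => simp [h2] at hn
    | succ a => exact ⟨b, a, h2⟩

/-! ### Generating functions of lattice walks -/

/-- The exponential generating function of the walks in `ℤ` which end at `m`: the coefficient of
`z ^ m` in `exp (X * (z + z⁻¹))`. -/
noncomputable def lineWalkSeries (m : ℤ) : PowerSeries ℚ :=
  PowerSeries.mk fun N => ∑ p ∈ antidiagonal N,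
    if (p.1 : ℤ) - p.2 = m then ((p.1.factorial : ℚ) * p.2.factorial)⁻¹ else 0

/-- Differentiating exp(X(z + z⁻¹)) in X multiplies it by z + z⁻¹, which shifts the endpoint by one
either way. -/
theorem derivative_lineWalkSeries (m : ℤ) : derivative ℚ (lineWalkSeries m) =
    lineWalkSeries (m - 1) + lineWalkSeries (m + 1) := by
  ext N
  rw [PowerSeries.coeff_derivative, map_add]
  simp only [lineWalkSeries, PowerSeries.coeff_mk]
  have h1 : ∀ p ∈ antidiagonal (N + 1),
      (if (p.1 : ℤ) - p.2 = m then ((p.1.factorial : ℚ) * p.2.factorial)⁻¹ else 0) *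
        ((N : ℚ) + 1) =
      (if (p.1 : ℤ) - p.2 = m then p.1 * ((p.1.factorial : ℚ) * p.2.factorial)⁻¹ else 0) +
      (if (p.1 : ℤ) - p.2 = m then p.2 * ((p.1.factorial : ℚ) * p.2.factorial)⁻¹ else 0) := by
    intro p hp
    have : (p.1 : ℚ) + p.2 = N + 1 := by exact_mod_cast mem_antidiagonal.1 hp
    rw [← this]
    split_ifs <;> ring
  rw [Finset.sum_mul, Finset.sum_congr rfl h1, Finset.sum_add_distrib,
    Finset.Nat.sum_antidiagonal_succ, Finset.Nat.sum_antidiagonal_succ']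
  simp only [Nat.cast_zero, zero_mul, ite_self, zero_add]
  have hf : ∀ k : ℕ, ((k.factorial : ℕ) : ℚ) ≠ 0 := fun k => by positivity
  have hk : ∀ k : ℕ, (k : ℚ) + 1 ≠ 0 := fun k => by positivity
  congr 1 <;> refine Finset.sum_congr rfl fun p _ => ?_
  · refine ite_congr (propext ?_) (fun _ => ?_) fun _ => rfl
    · push_cast
      omega
    · rw [Nat.factorial_succ]
      push_cast
      have := hf p.1
      have := hf p.2
      have := hk p.1
      field_simp
  · refine ite_congr (propext ?_) (fun _ => ?_) fun _ => rfl
    · push_cast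
      omega
    · rw [Nat.factorial_succ]
      push_cast
      have := hf p.1
      have := hf p.2
      have := hk p.2
      field_simp

/-- The exponential generating function of the walks in `ℤ^d` which end at `x`. -/
noncomputable def walkSeries {d : ℕ} (x : Fin d → ℤ) : PowerSeries ℚ :=
  ∏ i, lineWalkSeries (x i)

theorem derivative_prod_powerSeries {ι : Type*} [DecidableEq ι] (s : Finset ι)
    (f : ι → PowerSeries ℚ) : derivative ℚ (∏ i ∈ s, f i) =
      ∑ i ∈ s, derivative ℚ (f i) * ∏ j ∈ s \ {i}, f j := by
  induction s using Finset.induction_on with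
  | empty => simp
  | insert a s ha ih =>
    rw [Finset.prod_insert ha, Finset.sum_insert ha, Derivation.leibniz, ih, smul_eq_mul,
      smul_eq_mul, Finset.mul_sum, add_comm, mul_comm]
    congr 1
    · rw [Finset.insert_sdiff_of_mem _ (Finset.mem_singleton_self a),
        Finset.sdiff_singleton_eq_erase, Finset.erase_eq_of_notMem ha]
    · refine Finset.sum_congr rfl fun i hi => ?_
      have : a ∉ ({i} : Finset ι) := by
        rw [Finset.mem_singleton]
        rintro rfl
        exact ha hi
      rw [Finset.insert_sdiff_of_notMem _ this, Finset.prod_insert (by simp [ha])]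
      ring

/-- The unit steps of the lattice `ℤ^d`. -/
def latticeStep {d : ℕ} (s : Fin d × Bool) : Fin d → ℤ := Pi.single s.1 (if s.2 then 1 else -1)

theorem latticeStep_injective {d : ℕ} : Function.Injective (latticeStep (d := d)) := by
  rintro ⟨i, a⟩ ⟨j, b⟩ h
  simp only [latticeStep] at h
  have hne : ∀ c : Bool, (if c then 1 else -1 : ℤ) ≠ 0 := by decide
  have h1 := congrFun h i
  rw [Pi.single_eq_same] at h1
  by_cases hij : i = j
  · subst hij
    rw [Pi.single_eq_same] at h1
    cases a <;> cases b <;> simp_all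
  · rw [Pi.single_eq_of_ne hij] at h1
    exact absurd h1 (hne a)

theorem sum_abs_eq_one_iff {d : ℕ} (y : Fin d → ℤ) :
    ∑ i, |y i| = 1 ↔ ∃ s, y = latticeStep s := by
  constructor
  · intro h
    obtain ⟨i, hi⟩ : ∃ i, y i ≠ 0 := by
      by_contra! h0
      simp [h0] at h
    rw [← Finset.add_sum_erase _ _ (Finset.mem_univ i)] at h
    have h1 : 1 ≤ |y i| := Int.one_le_abs hi
    have h2 : 0 ≤ ∑ j ∈ Finset.univ.erase i, |y j| := Finset.sum_nonneg fun _ _ => abs_nonneg _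
    have h3 : ∑ j ∈ Finset.univ.erase i, |y j| = 0 := by omega
    rw [Finset.sum_eq_zero_iff_of_nonneg fun _ _ => abs_nonneg _] at h3
    have hz : ∀ j, j ≠ i → y j = 0 := fun j hj =>
      abs_eq_zero.1 (h3 j (Finset.mem_erase.2 ⟨hj, Finset.mem_univ j⟩))
    have hy : y = Pi.single i (y i) := by
      ext j
      by_cases hj : j = i
      · subst hj; simp
      · simp [hj, hz j hj]
    rcases abs_eq (zero_le_one' ℤ) |>.1 (show |y i| = 1 by omega) with h4 | h4
    · exact ⟨(i, true), by rw [hy, h4]; simp [latticeStep]⟩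
    · exact ⟨(i, false), by rw [hy, h4]; simp [latticeStep]⟩
  · rintro ⟨⟨i, b⟩, rfl⟩
    rw [Finset.sum_eq_single i]
    · cases b <;> simp [latticeStep]
    · intro j _ hj
      simp [latticeStep, hj]
    · simp

theorem derivative_walkSeries {d : ℕ} (x : Fin d → ℤ) :
    derivative ℚ (walkSeries x) = ∑ s, walkSeries (x - latticeStep s) := by
  have key : ∀ s : Fin d × Bool, walkSeries (x - latticeStep s) =
      lineWalkSeries (x s.1 - if s.2 then 1 else -1) *
        ∏ j ∈ Finset.univ \ {s.1}, lineWalkSeries (x j) := by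
    rintro ⟨i, b⟩
    rw [walkSeries, ← Finset.mul_prod_erase _ _ (Finset.mem_univ i),
      Finset.sdiff_singleton_eq_erase]
    congr 1
    · simp [latticeStep]
    · refine Finset.prod_congr rfl fun j hj => ?_
      simp [latticeStep, (Finset.mem_erase.1 hj).1]
  rw [walkSeries, derivative_prod_powerSeries, Fintype.sum_prod_type]
  refine Finset.sum_congr rfl fun i _ => ?_
  simp only [key, Fintype.sum_bool, derivative_lineWalkSeries]
  simp [add_mul]

/-- The `N`-step walks in `ℤ^d` from the origin to `x`. -/
def walksTo {d : ℕ} (N : ℕ) (x : Fin d → ℤ) : Set (Fin (N + 1) → Fin d → ℤ) :=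
  {p | p 0 = 0 ∧ p (Fin.last N) = x ∧
    ∀ k : Fin N, ∑ i : Fin d, |p k.succ i - p k.castSucc i| = 1}

theorem walksTo_succ {d : ℕ} (N : ℕ) (x : Fin d → ℤ) : walksTo (N + 1) x =
    ⋃ s, (fun p => (Fin.snoc p x : Fin (N + 1 + 1) → Fin d → ℤ)) ''
      walksTo N (x - latticeStep s) := by
  have hmem : ∀ p : Fin (N + 1) → Fin d → ℤ, (Fin.snoc p x : Fin (N + 1 + 1) → Fin d → ℤ) ∈
      walksTo (N + 1) x ↔ ∃ s, p ∈ walksTo N (x - latticeStep s) := by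
    intro p
    have h1 := sum_abs_eq_one_iff (x - p (Fin.last N))
    simp only [Pi.sub_apply] at h1
    simp only [walksTo, Set.mem_ofPred_eq, Fin.snoc_apply_zero, Fin.snoc_last, true_and,
      Fin.forall_fin_succ', Fin.succ_castSucc, Fin.snoc_castSucc, Fin.succ_last, h1]
    constructor
    · rintro ⟨h2, h3, s, h4⟩
      exact ⟨s, h2, by rw [← h4, sub_sub_cancel], h3⟩
    · rintro ⟨s, h2, h3, h4⟩
      exact ⟨h2, h4, s, by rw [h3, sub_sub_cancel]⟩
  ext q
  rw [Set.mem_iUnion]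
  constructor
  · intro hq
    have hlast : q (Fin.last (N + 1)) = x := hq.2.1
    have hsn : (Fin.snoc (Fin.init q) x : Fin (N + 1 + 1) → Fin d → ℤ) = q := by
      rw [← hlast]
      exact Fin.snoc_init_self q
    rw [← hsn, hmem] at hq
    obtain ⟨s, hs⟩ := hq
    exact ⟨s, Fin.init q, hs, hsn⟩
  · rintro ⟨s, p, hp, rfl⟩
    exact (hmem p).2 ⟨s, hp⟩

theorem coeff_zero_walkSeries {d : ℕ} (x : Fin d → ℤ) :
    coeff 0 (walkSeries x) = if x = 0 then 1 else 0 := by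
  have h : ∀ i, coeff 0 (lineWalkSeries (x i)) = if x i = 0 then 1 else 0 := by
    intro i
    simp [lineWalkSeries, eq_comm]
  rw [walkSeries, PowerSeries.coeff_zero_eq_constantCoeff_apply, map_prod]
  simp only [← PowerSeries.coeff_zero_eq_constantCoeff_apply, h]
  rw [Finset.prod_ite_zero]
  simp [funext_iff]

/-- Removing the last step of a walk matches differentiating its exponential generating function, so
both sides obey the same recurrence. Finiteness is carried along because `Set.ncard` is additive
only over finite sets. -/
theorem ncard_walksTo {d : ℕ} (N : ℕ) (x : Fin d → ℤ) : (walksTo N x).Finite ∧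
    ((walksTo N x).ncard : ℚ) = N.factorial * coeff N (walkSeries x) := by
  induction N generalizing x with
  | zero =>
    rw [coeff_zero_walkSeries]
    split_ifs with hx
    · have : walksTo 0 x = {fun _ => 0} := by
        ext p
        simp only [walksTo, hx, Set.mem_ofPred_eq, Set.mem_singleton_iff, funext_iff]
        simp [Fin.forall_fin_one]
      rw [this]
      simp
    · have : walksTo 0 x = ∅ := by
        rw [Set.eq_empty_iff_forall_notMem]
        rintro p ⟨h1, h2, -⟩
        exact hx (h2.symm.trans h1)
      rw [this]
      simp
  | succ N ih =>
    have hfin : ∀ s, ((fun p => (Fin.snoc p x : Fin (N + 1 + 1) → Fin d → ℤ)) ''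
        walksTo N (x - latticeStep s)).Finite := fun s => (ih _).1.image _
    have hinj : Function.Injective
        (fun p => (Fin.snoc p x : Fin (N + 1 + 1) → Fin d → ℤ)) := 
      Fin.snoc_left_injective (α := fun _ => Fin d → ℤ) x
    rw [walksTo_succ]
    refine ⟨Set.finite_iUnion hfin, ?_⟩
    rw [Set.ncard_iUnion_of_finite hfin, finsum_eq_sum_of_fintype]
    · simp only [Set.ncard_image_of_injective _ hinj]
      push_cast
      rw [Finset.sum_congr rfl fun s _ => (ih (x - latticeStep s)).2, ← Finset.mul_sum,
        ← map_sum, ← derivative_walkSeries, PowerSeries.coeff_derivative, Nat.factorial_succ]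
      push_cast
      ring
    · intro s t hst
      rw [Function.onFun, Set.disjoint_left]
      rintro _ ⟨p, hp, rfl⟩ ⟨p', hp', hpp⟩
      obtain rfl := hinj hpp
      exact hst (latticeStep_injective (sub_right_injective (hp.2.1.symm.trans hp'.2.1)))

/-! ### The Bessel series and its differential equations -/

/-- The series `∑ Xⁿ / n!²`. -/
noncomputable def besselSeries : PowerSeries ℚ :=
  PowerSeries.mk fun n => ((n.factorial : ℚ) ^ 2)⁻¹

theorem lineWalkSeries_zero :
    lineWalkSeries 0 = PowerSeries.expand 2 two_ne_zero besselSeries := by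
  ext N
  rw [PowerSeries.coeff_expand]
  simp only [lineWalkSeries, besselSeries, PowerSeries.coeff_mk]
  split_ifs with h
  · obtain ⟨k, rfl⟩ := h
    rw [Nat.mul_div_cancel_left _ two_pos,
      Finset.sum_eq_single_of_mem (k, k) (mem_antidiagonal.2 (by simp only; ring))]
    · simp [sq]
    · rintro ⟨i, j⟩ hp hne
      rw [mem_antidiagonal] at hp
      refine if_neg fun hh => hne ?_
      ext <;> simp only at * <;> omega
  · refine Finset.sum_eq_zero fun p hp => if_neg fun hh => h ?_
    rw [mem_antidiagonal] at hp
    omega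

theorem walkCount_eq (d n : ℕ) :
    (walkCount d n : ℚ) = (2 * n).factorial * coeff n (besselSeries ^ d) := by
  have h := (ncard_walksTo (2 * n) (0 : Fin d → ℤ)).2
  rw [walkSeries] at h
  simp only [Pi.zero_apply, Finset.prod_const, Finset.card_univ, Fintype.card_fin] at h
  rw [lineWalkSeries_zero, ← map_pow, PowerSeries.coeff_expand_mul] at h
  -- `closedWalks d n` unfolds to `walksTo (2 * n) 0`.
  exact h

theorem constantCoeff_besselSeries : PowerSeries.constantCoeff besselSeries = 1 := by
  rw [← PowerSeries.coeff_zero_eq_constantCoeff_apply]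
  simp [besselSeries]

theorem derivative_X_mul_derivative_besselSeries :
    derivative ℚ (PowerSeries.X * derivative ℚ besselSeries) = besselSeries := by
  ext n
  rw [PowerSeries.coeff_derivative, PowerSeries.coeff_succ_X_mul, PowerSeries.coeff_derivative]
  simp only [besselSeries, PowerSeries.coeff_mk, Nat.factorial_succ]
  have : (n : ℚ) + 1 ≠ 0 := by positivity
  have : (n.factorial : ℚ) ≠ 0 := by positivity
  push_cast
  field_simp

/-- The logarithmic derivative of the Bessel series. -/
noncomputable def besselLogDeriv : PowerSeries ℚ :=
  PowerSeries.X * derivative ℚ besselSeries * besselSeries⁻¹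

theorem besselSeries_mul_inv : besselSeries * besselSeries⁻¹ = 1 :=
  PowerSeries.mul_inv_cancel _ (by rw [constantCoeff_besselSeries]; exact one_ne_zero)

/-- The second-order equation (xB')' = B becomes a first-order Riccati equation for the logarithmic
derivative. -/
theorem X_mul_derivative_besselLogDeriv :
    PowerSeries.X * derivative ℚ besselLogDeriv = PowerSeries.X - besselLogDeriv ^ 2 := by
  rw [besselLogDeriv, Derivation.leibniz, derivative_X_mul_derivative_besselSeries,
    PowerSeries.derivative_inv', smul_eq_mul, smul_eq_mul]
  linear_combination PowerSeries.X * besselSeries_mul_inv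

theorem X_mul_derivative_besselSeries_pow (d : ℕ) :
    PowerSeries.X * derivative ℚ (besselSeries ^ d) =
      (d : PowerSeries ℚ) * (besselLogDeriv * besselSeries ^ d) := by
  cases d with
  | zero => simp
  | succ d =>
    rw [PowerSeries.derivative_pow, besselLogDeriv, Nat.add_sub_cancel]
    linear_combination -(((d + 1 : ℕ) : PowerSeries ℚ) * PowerSeries.X *
      derivative ℚ besselSeries * besselSeries ^ d) * besselSeries_mul_inv

theorem coeff_X_mul_derivative (f : PowerSeries ℚ) (n : ℕ) :
    coeff n (PowerSeries.X * derivative ℚ f) = n * coeff n f := by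
  cases n with
  | zero => simp
  | succ n =>
    rw [PowerSeries.coeff_succ_X_mul, PowerSeries.coeff_derivative]
    push_cast
    ring

theorem walkCount_pos {d : ℕ} (hd : 0 < d) (n : ℕ) : 0 < walkCount d n := by
  rw [walkCount, Set.ncard_pos (closedWalks_finite d n)]
  let i : Fin d := ⟨0, hd⟩
  -- The walk oscillates between the origin and one of its neighbours.
  refine ⟨fun k => if Even (k : ℕ) then 0 else Pi.single i 1, by simp, by simp, fun k => ?_⟩
  have h := sum_abs_eq_one_iff (fun j =>
    (if Even (k.succ : ℕ) then 0 else Pi.single i 1 : Fin d → ℤ) j -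
    (if Even (k.castSucc : ℕ) then 0 else Pi.single i 1 : Fin d → ℤ) j)
  refine h.2 ⟨(i, decide (Even (k : ℕ))), ?_⟩
  ext j
  by_cases hk : Even (k : ℕ) <;> simp [hk, Nat.even_add_one, latticeStep, Pi.single_neg]

theorem mainTheorem1 (d n : ℕ) (hd : 0 < d) (hn : 0 < n) :
    (padicValNat 2 d = 0 → walkVal d n = binaryOnes n) ∧
    (padicValNat 2 d = 1 → walkVal d n = 2 * binaryOnes n) ∧
    (padicValNat 2 d = 2 →
      3 * binaryOnes n ≤ walkVal d n ∧
      (walkVal d n = 3 * binaryOnes n ↔ ¬ [1, 1] <:+: binaryExpansion n)) ∧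
    (3 ≤ padicValNat 2 d →
      3 * binaryOnes n + (padicValNat 2 d - 2) ≤ walkVal d n ∧
      (walkVal d n = 3 * binaryOnes n + (padicValNat 2 d - 2) ↔
        ∃ a b : ℕ, binaryExpansion n = List.replicate a 1 ++ List.replicate b 0)) := by
  rw [← onesThenZeroes_iff hn]
  refine padicValNat_of_recurrence (l := fun k => coeff k besselLogDeriv)
    (g := fun k => coeff k (besselSeries ^ d)) hd hn (walkCount_pos hd n) (walkCount_eq d n)
    ?_ ?_ ?_ ?_
  · simp [besselLogDeriv]
  · simp [constantCoeff_besselSeries]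
  · intro k _
    rw [← coeff_X_mul_derivative, X_mul_derivative_besselLogDeriv, map_sub,
      PowerSeries.coeff_X, sq, PowerSeries.coeff_mul]
  · intro k _
    rw [← coeff_X_mul_derivative, X_mul_derivative_besselSeries_pow, ← PowerSeries.coeff_mul,
      ← nsmul_eq_mul, map_nsmul, nsmul_eq_mul]
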